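/- Let $X$ be a Tychonoff (completely regular Hausdorff) space and let $C_k(X)$ be the locally convex space of all continuous real-valued functions on $X$ with the compact-open topology. A real locally convex space $E$ has the Grothendieck property if every weak-$\ast$ convergent sequence in its dual $E'$ converges in the weak topology of the strong dual $E'_\beta$ (that is, of $E'$ with the topology of uniform convergence on bounded subsets of $E$). A subset $A\subseteq X$ is functionally bounded in $X$ if every continuous $f:X\to\mathbb{R}$ is bounded on $A$; a Tychonoff space is a $\mu$-space if each of its functionally bounded subsets has compact closure; a Tychonoff space is cosmic if it is a continuous image of a separable metrizable space. A topological space is sequential if every non-closed subset $A$ of it contains a sequence converging to a point outside $A$. (i) If $X$ is a $\mu$-space all of whose compact subsets are sequential, then $C_k(X)$ has the Grothendieck property if and only if every functionally bounded subset of $X$ is finite. Every cosmic space $X$ satisfies these hypotheses: it is a $\mu$-space and all of its compact subsets are sequential. (ii) If $X$ is a sequential space, then $C_k(X)$ has the Grothendieck property if and only if $X$ is discrete. -/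

import Mathlib

open Filter Topology

universe u v

/-- A real locally convex space `E` has the *Grothendieck property* if every weak-* convergent
sequence in its dual is convergent in the weak topology of the strong dual. Here `StrongDual ℝ E`
carries the topology of uniform convergence on bounded subsets of `E`, `WeakDual ℝ E` the topology
of pointwise convergence on `E`, and `WeakSpace ℝ (StrongDual ℝ E)` the topology of pointwise
convergence against all strongly continuous linear functionals on `StrongDual ℝ E`. -/
def GrothendieckProperty (E : Type*) [AddCommGroup E] [Module ℝ E] [TopologicalSpace E]
    [IsTopologicalAddGroup E] [ContinuousSMul ℝ E] [LocallyConvexSpace ℝ E] : Prop :=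
  ∀ χ : ℕ → StrongDual ℝ E,
    (∃ l : WeakDual ℝ E,
      Tendsto (fun n => StrongDual.toWeakDual (χ n)) atTop (𝓝 l)) →
    ∃ l : WeakSpace ℝ (StrongDual ℝ E),
      Tendsto (fun n => toWeakSpace ℝ (StrongDual ℝ E) (χ n)) atTop (𝓝 l)

/-- `A` is *functionally bounded* in `X` if every continuous real function on `X` is bounded
on `A`. -/
def IsFunctionallyBounded {X : Type*} [TopologicalSpace X] (A : Set X) : Prop :=
  ∀ f : C(X, ℝ), Bornology.IsBounded (f '' A)

/-- A *`μ`-space* is a Tychonoff space whose functionally bounded subsets are relatively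
compact. -/
def IsMuSpace (X : Type*) [TopologicalSpace X] : Prop :=
  T35Space X ∧ ∀ A : Set X, IsFunctionallyBounded A → IsCompact (closure A)

/-- A *cosmic* space is a Tychonoff space which is a continuous image of a separable metrizable
space (`Y`, of any universe level). -/
def IsCosmic (X : Type u) [TopologicalSpace X] : Prop :=
  T35Space X ∧ ∃ (Y : Type v) (_ : TopologicalSpace Y), TopologicalSpace.MetrizableSpace Y ∧
    TopologicalSpace.SeparableSpace Y ∧ ∃ f : Y → X, Continuous f ∧ Function.Surjective f

/-! Necessity: if `u n → p` with `u n ≠ p`, point evaluations converge weak-* to evaluation at `p`.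
Bumps `f k` with value 1 at `p` and 0 at `u 0, …, u k` form a bounded set, and an ultrafilter limit
of evaluation at `f k` is a functional on the strong dual that is 0 at every `u n` and 1 at `p`. So
the Grothendieck property makes sequential compact sets finite
(`GrothendieckProperty.finite_of_isCompact`). Sufficiency: if functionally bounded sets are finite,
so are compact ones, and functionals are finite sums of point evaluations. A gliding hump
(`isFunctionallyBounded_iUnion_support`) puts the supports of a weak-* null sequence in one finite
set, and everything becomes finite-dimensional. Cosmic spaces are Lindelöf and have a countable
separating family of functions. -/

section WeakSpace

/-- Convergence in the weak topology is convergence against all continuous functionals. -/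
theorem tendsto_toWeakSpace_iff {ι E : Type*} [AddCommGroup E] [Module ℝ E] [TopologicalSpace E]
    {F : Filter ι} {u : ι → E} {l : WeakSpace ℝ E} :
    Tendsto (fun i => toWeakSpace ℝ E (u i)) F (𝓝 l) ↔
      ∀ φ : StrongDual ℝ E, Tendsto (fun i => φ (u i)) F (𝓝 (φ ((toWeakSpace ℝ E).symm l))) := by
  have h : 𝓝 l = comap (fun (x : WeakSpace ℝ E) (φ : StrongDual ℝ E) =>
      φ ((toWeakSpace ℝ E).symm x)) (𝓝 fun φ => φ ((toWeakSpace ℝ E).symm l)) :=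
    nhds_induced _ _
  rw [h, tendsto_comap_iff, tendsto_pi_nhds]
  rfl

variable {E : Type*} [AddCommGroup E] [Module ℝ E] [TopologicalSpace E]

/-- A limit of evaluations along a bounded sequence, as a functional on the strong dual. -/
theorem exists_strongDual_limit (f : ℕ → E) (hf : Bornology.IsVonNBounded ℝ (Set.range f)) :
    ∃ φ : StrongDual ℝ (StrongDual ℝ E), ∀ χ a,
      Tendsto (fun k => χ (f k)) atTop (𝓝 a) → φ χ = a := by
  -- One ultrafilter serves every `χ`, so uniqueness of limits makes the limit linear in `χ`.
  have key : ∀ χ : StrongDual ℝ E, ∃ a : ℝ,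
      Tendsto (fun k => χ (f k)) (hyperfilter ℕ : Filter ℕ) (𝓝 a) := by
    intro χ
    have hb : Bornology.IsBounded (χ '' Set.range f) :=
      (NormedSpace.isVonNBounded_iff ℝ).1 (hf.image χ)
    obtain ⟨a, -, ha⟩ := hb.isCompact_closure.ultrafilter_le_nhds
      ((hyperfilter ℕ).map fun k => χ (f k)) (by
        rw [le_principal_iff]
        refine Filter.mem_map.2 (univ_mem' fun k => ?_)
        exact subset_closure ⟨f k, ⟨k, rfl⟩, rfl⟩)
    exact ⟨a, ha⟩
  choose φ hφ using key
  let L : StrongDual ℝ E →ₗ[ℝ] ℝ :=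
    { toFun := φ
      map_add' := fun χ ψ => tendsto_nhds_unique (hφ (χ + ψ)) ((hφ χ).add (hφ ψ))
      map_smul' := fun c χ => tendsto_nhds_unique (hφ (c • χ)) ((hφ χ).const_smul c) }
  refine ⟨⟨L, continuous_of_tendsto_nhds_zero L ?_⟩, fun χ a ha => ?_⟩
  · rw [Metric.nhds_basis_closedBall.tendsto_right_iff]
    intro ε hε
    have := ContinuousLinearMap.eventually_nhds_zero_mapsTo (σ := RingHom.id ℝ) (E := E)
      hf (Metric.closedBall_mem_nhds (0 : ℝ) hε)
    filter_upwards [this] with χ hχ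
    exact Metric.isClosed_closedBall.mem_of_tendsto (hφ χ)
      (Eventually.of_forall fun k => hχ ⟨k, rfl⟩)
  · exact tendsto_nhds_unique (hφ χ) (ha.mono_left Nat.hyperfilter_le_atTop)

/-- Evaluation at a vector, as a functional on the strong dual. -/
theorem exists_strongDual_eval [ContinuousSMul ℝ E] (x : E) :
    ∃ φ : StrongDual ℝ (StrongDual ℝ E), ∀ χ, φ χ = χ x := by
  obtain ⟨φ, hφ⟩ := exists_strongDual_limit (fun _ => x) (by
    rw [Set.range_const]; exact Bornology.isVonNBounded_singleton x)
  exact ⟨φ, fun χ => hφ χ _ tendsto_const_nhds⟩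

end WeakSpace

/-! ### Functionals on `C(X, ℝ)` and the convergent-sequence obstruction. -/

section ContinuousFunctions

variable {X : Type*} [TopologicalSpace X]

/-- Uniformly bounded families are bounded in the compact-open topology. -/
theorem isVonNBounded_of_abs_le_one {S : Set C(X, ℝ)} (hS : ∀ f ∈ S, ∀ x, |f x| ≤ 1) :
    Bornology.IsVonNBounded ℝ S := by
  refine Bornology.isVonNBounded_of_smul_tendsto_zero (𝕜 := ℝ) (ε := fun n : ℕ => 1 / ((n : ℝ) + 1))
    (l := atTop) (Eventually.of_forall fun n => by positivity) fun u hu => ?_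
  rw [ContinuousMap.tendsto_iff_forall_isCompact_tendstoUniformlyOn]
  intro K _
  rw [Metric.tendstoUniformlyOn_iff]
  intro ε hε
  filter_upwards [(tendsto_one_div_add_atTop_nhds_zero_nat (𝕜 := ℝ)).eventually (gt_mem_nhds hε)]
    with n hn x _
  have h1 : |u n x| ≤ 1 := hS _ (hu n) x
  have h2 : (0 : ℝ) ≤ 1 / ((n : ℝ) + 1) := by positivity
  simp only [ContinuousMap.zero_apply, Pi.smul_apply', ContinuousMap.smul_apply, smul_eq_mul,
    dist_zero_left, Real.norm_eq_abs, abs_mul, abs_of_nonneg h2]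
  nlinarith [abs_nonneg (u n x)]

/-- A continuous functional on `C(X, ℝ)` is supported by a compact set. -/
theorem exists_isCompact_forall_eq_zero (χ : StrongDual ℝ C(X, ℝ)) :
    ∃ K : Set X, IsCompact K ∧ ∀ f : C(X, ℝ), (∀ x ∈ K, f x = 0) → χ f = 0 := by
  have h0 : {f : C(X, ℝ) | |χ f| < 1} ∈ 𝓝 (0 : C(X, ℝ)) := by
    have : Tendsto (fun f => |χ f|) (𝓝 0) (𝓝 |χ 0|) := (χ.continuous.abs).tendsto 0
    refine this.eventually (gt_mem_nhds ?_)
    simp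
  obtain ⟨⟨K, V⟩, ⟨hK, hV⟩, hKV⟩ := (nhds_basis_uniformity'
    ContinuousMap.hasBasis_compactConvergenceUniformity).mem_iff.1 h0
  refine ⟨K, hK, fun f hf => ?_⟩
  -- Every multiple of `f` still vanishes on `K`, hence stays in the basic neighbourhood.
  have hn : ∀ n : ℕ, n * |χ f| < 1 := by
    intro n
    have : (n : ℝ) • f ∈ {f : C(X, ℝ) | |χ f| < 1} := by
      refine hKV fun x hx => ?_
      simpa [hf x hx] using refl_mem_uniformity hV
    simpa [abs_mul] using this
  by_contra hne
  obtain ⟨n, hlt⟩ := exists_nat_gt (1 / |χ f|)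
  rw [div_lt_iff₀ (abs_pos.2 hne)] at hlt
  exact (hn n).not_gt hlt

theorem exists_bump [CompletelyRegularSpace X] {p : X} {A : Set X} (hA : IsClosed A)
    (hp : p ∉ A) : ∃ f : C(X, ℝ), f p = 1 ∧ (∀ x ∈ A, f x = 0) ∧ ∀ x, 0 ≤ f x ∧ f x ≤ 1 := by
  obtain ⟨f, hf, h0, h1⟩ := CompletelyRegularSpace.completely_regular p A hA hp
  refine ⟨⟨fun x => 1 - (f x : ℝ), by fun_prop⟩, by simp [h0], fun x hx => ?_, fun x => ?_⟩
  · simp [h1 hx]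
  · have := (f x).2
    constructor <;> simp [this.1, this.2]

/-- A functional on `C(X, ℝ)` is a finite combination of point evaluations if the compact subsets
of `X` are finite. -/
theorem exists_finsupp_of_compact_finite [T35Space X] (hX : ∀ K : Set X, IsCompact K → K.Finite)
    (χ : StrongDual ℝ C(X, ℝ)) :
    ∃ c : X →₀ ℝ, ∀ f : C(X, ℝ), χ f = ∑ x ∈ c.support, c x * f x := by
  classical
  obtain ⟨K, hK, hχ⟩ := exists_isCompact_forall_eq_zero χ
  obtain ⟨K, rfl⟩ := (hX K hK).exists_finset_coe
  have hb : ∀ x : X, ∃ e : C(X, ℝ), e x = 1 ∧ ∀ y ∈ K, y ≠ x → e y = 0 := by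
    intro x
    obtain ⟨e, h1, h0, -⟩ := exists_bump (p := x) (K.erase x).finite_toSet.isClosed (by simp)
    exact ⟨e, h1, fun y hy hyx => h0 y (by simp [hy, hyx])⟩
  choose e he1 he0 using hb
  refine ⟨Finsupp.onFinset K (fun x => if x ∈ K then χ (e x) else 0) (by
    intro x hx; by_contra h; simp [h] at hx), fun f => ?_⟩
  have h := hχ (f - ∑ x ∈ K, f x • e x) (by
    intro y hy
    have : ∑ x ∈ K, f x * e x y = f y := by
      rw [Finset.sum_eq_single_of_mem y hy fun x _ hxy => by rw [he0 x y hy hxy.symm, mul_zero],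
        he1, mul_one]
    simp [ContinuousMap.sum_apply, this])
  rw [map_sub, sub_eq_zero, map_sum] at h
  rw [h, Finset.sum_subset (Finsupp.support_onFinset_subset) (fun x _ hx => by
    rw [Finsupp.notMem_support_iff.1 hx, zero_mul])]
  refine Finset.sum_congr rfl fun x hx => ?_
  simp [hx, mul_comm]

/-- A nontrivial convergent sequence in `X` prevents `C(X, ℝ)` from having the Grothendieck
property. -/
theorem not_grothendieckProperty_of_tendsto [T35Space X] {u : ℕ → X} {p : X}
    (hu : Tendsto u atTop (𝓝 p)) (hne : ∀ n, u n ≠ p) : ¬ GrothendieckProperty C(X, ℝ) := by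
  intro hG
  obtain ⟨l, hl⟩ := hG (fun n => ContinuousMap.evalCLM ℝ (u n))
    ⟨StrongDual.toWeakDual (ContinuousMap.evalCLM ℝ p), by
      rw [tendsto_iff_forall_eval_tendsto_topDualPairing]
      exact fun f => (f.continuous.tendsto p).comp hu⟩
  rw [tendsto_toWeakSpace_iff] at hl
  set m := (toWeakSpace ℝ (StrongDual ℝ C(X, ℝ))).symm l
  have hm : ∀ f : C(X, ℝ), m f = f p := by
    intro f
    obtain ⟨φ, hφ⟩ := exists_strongDual_eval f
    have h := hl φ
    simp only [hφ] at h
    exact tendsto_nhds_unique h ((f.continuous.tendsto p).comp hu)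
  have hb : ∀ k : ℕ, ∃ f : C(X, ℝ), f p = 1 ∧ (∀ x ∈ u '' Set.Iic k, f x = 0) ∧
      ∀ x, 0 ≤ f x ∧ f x ≤ 1 := fun k =>
    exists_bump ((Set.finite_Iic k).image u).isClosed (by
      rintro ⟨n, -, hn⟩; exact hne n hn)
  choose f hf1 hf0 hf using hb
  obtain ⟨φ, hφ⟩ := exists_strongDual_limit f (isVonNBounded_of_abs_le_one (by
    rintro _ ⟨k, rfl⟩ x
    exact abs_le.2 ⟨by linarith [(hf k x).1], (hf k x).2⟩))
  have h1 : φ m = 1 := hφ m 1 (by simp [hm, hf1])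
  have h0 : ∀ n, φ (ContinuousMap.evalCLM ℝ (u n)) = 0 := by
    intro n
    refine hφ _ 0 (tendsto_const_nhds.congr' ?_)
    filter_upwards [eventually_ge_atTop n] with k hk
    exact (hf0 k _ ⟨n, hk, rfl⟩).symm
  have h := hl φ
  simp only [h0, h1] at h
  exact zero_ne_one (tendsto_nhds_unique tendsto_const_nhds h)

/-- In a space which is sequential but not discrete there is a nontrivial convergent sequence. -/
theorem exists_tendsto_ne_of_not_discreteTopology [SequentialSpace X]
    (h : ¬ DiscreteTopology X) :
    ∃ (u : ℕ → X) (p : X), Tendsto u atTop (𝓝 p) ∧ ∀ n, u n ≠ p := by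
  contrapose! h
  refine discreteTopology_iff_isOpen_singleton.2 fun p => ?_
  rw [← isClosed_compl_iff]
  refine IsSeqClosed.isClosed fun u q hu hq => ?_
  rintro rfl
  obtain ⟨n, hn⟩ := h u q hq
  exact hu n hn

end ContinuousFunctions

/-! ### Gliding hump and sufficiency. -/

section FiniteCombinations

/-- Lower triangular systems with nonzero diagonal are solvable. -/
theorem exists_triangular_solution (M : ℕ → ℕ → ℝ) (hM : ∀ k, M k k ≠ 0) (b : ℕ → ℝ) :
    ∃ a : ℕ → ℝ, ∀ k, ∑ j ∈ Finset.range (k + 1), a j * M k j = b k := by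
  let step : ∀ k, (∀ j, j < k → ℝ) → ℝ := fun k r =>
    (b k - ∑ j : Fin k, r j j.2 * M k j) / M k k
  let a : ℕ → ℝ := fun k => Nat.strongRec (motive := fun _ => ℝ) step k
  have ha : ∀ k, a k = (b k - ∑ j : Fin k, a j * M k j) / M k k := fun k =>
    Nat.strongRec_eq _ k
  refine ⟨a, fun k => ?_⟩
  rw [Finset.sum_range_succ, ha k, div_mul_cancel₀ _ (hM k), Finset.sum_range]
  ring

variable {X : Type*} [TopologicalSpace X]

/-- The supports of a pointwise convergent sequence of finitely supported functionals have a
functionally bounded union. -/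
theorem isFunctionallyBounded_iUnion_support [T35Space X] (c : ℕ → X →₀ ℝ)
    (hc : ∀ f : C(X, ℝ), Tendsto (fun n => ∑ x ∈ (c n).support, c n x * f x) atTop (𝓝 0)) :
    IsFunctionallyBounded (⋃ n, ((c n).support : Set X)) := by
  classical
  intro h
  by_contra hunb
  have hlarge : ∀ C : ℝ, ∃ q : X × ℕ, q.1 ∈ (c q.2).support ∧ C < |h q.1| := by
    intro C
    by_contra! hC
    refine hunb ((Metric.isBounded_closedBall (x := (0 : ℝ)) (r := C)).subset ?_)
    rintro _ ⟨x, hx, rfl⟩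
    obtain ⟨n, hn⟩ := Set.mem_iUnion.1 hx
    simpa using hC (x, n) hn
  -- Each new point has `|h|` more than 1 above its values on all earlier chosen supports.
  obtain ⟨q, hq, hqr⟩ := exists_seq_of_forall_finset_exists
    (fun q : X × ℕ => q.1 ∈ (c q.2).support)
    (fun q q' : X × ℕ => ∀ t ∈ (c q.2).support, |h t| + 1 < |h q'.1|) (by
      intro s _
      obtain ⟨C, hC⟩ := ((s.biUnion fun q => (c q.2).support).image fun t => |h t| + 1).bddAbove
      obtain ⟨q', hq', hlt⟩ := hlarge C
      refine ⟨q', hq', fun q hqs t ht => lt_of_le_of_lt (hC ?_) hlt⟩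
      simp only [Finset.coe_image, Set.mem_image, Finset.mem_coe, Finset.mem_biUnion]
      exact ⟨t, ⟨q, hqs, ht⟩, rfl⟩)
  have hgrow : ∀ k : ℕ, (k : ℝ) ≤ |h (q k).1| := by
    intro k
    induction k with
    | zero => simp
    | succ k ih =>
      have := hqr k (k + 1) k.lt_succ_self _ (hq k)
      push_cast
      linarith
  -- The bump `e k` vanishes on the earlier chosen supports and at the other points of its own, so
  -- the matrix of pairings is triangular with nonzero diagonal.
  have hb : ∀ k : ℕ, ∃ e : C(X, ℝ), e (q k).1 = 1 ∧
      (∀ x ∈ {x | |h x| ≤ |h (q k).1| - 1} ∪ ((c (q k).2).support.erase (q k).1 : Finset X),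
        e x = 0) ∧ ∀ x, 0 ≤ e x ∧ e x ≤ 1 := fun k =>
    exists_bump ((isClosed_le (by fun_prop) continuous_const).union
      (Finset.finite_toSet _).isClosed) (by simp)
  choose e he1 he0 _ using hb
  set T : ℕ → C(X, ℝ) → ℝ := fun n f => ∑ x ∈ (c n).support, c n x * f x with hT
  obtain ⟨a, ha⟩ := exists_triangular_solution (fun k j => T (q k).2 (e j)) (by
    intro k
    have : T (q k).2 (e k) = c (q k).2 (q k).1 := by
      rw [hT]
      dsimp only
      rw [Finset.sum_eq_single_of_mem _ (hq k) fun x hx hne => by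
        rw [he0 k x (Or.inr (by simpa [hne] using hx)), mul_zero], he1, mul_one]
    rw [this]
    exact Finsupp.mem_support_iff.1 (hq k)) (fun k => k)
  -- Where `|h|` is bounded only finitely many bumps survive; this gives local finiteness of the sum
  -- `g`.
  have hvan : ∀ (k : ℕ) (x : X), |h x| + 1 ≤ k → e k x = 0 := fun k x hx =>
    he0 k x (Or.inl (by have := hgrow k; simp only [Set.mem_ofPred_eq]; linarith))
  have hlf : LocallyFinite fun k => Function.support fun x => a k * e k x := by
    intro x
    refine ⟨{y | |h y| < |h x| + 1}, (isOpen_lt (by fun_prop) continuous_const).mem_nhds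
      (by simp), ?_⟩
    obtain ⟨N, hN⟩ := exists_nat_gt (|h x| + 2)
    refine (Set.finite_Iio N).subset ?_
    rintro k ⟨y, hy, hyx⟩
    by_contra hk
    have hNk : (N : ℝ) ≤ k := by exact_mod_cast not_lt.1 hk
    refine hy ?_
    have hyx' : |h y| < |h x| + 1 := hyx
    simp only [hvan k y (by linarith), mul_zero]
  let g : C(X, ℝ) := ⟨fun x => ∑ᶠ k, a k * e k x,
    continuous_finsum (fun k => by fun_prop) hlf⟩
  have hg : ∀ k : ℕ, T (q k).2 g = k := by
    intro k
    rw [← ha k]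
    simp only [hT, Finset.mul_sum]
    rw [Finset.sum_comm]
    refine Finset.sum_congr rfl fun x hx => ?_
    have : g x = ∑ j ∈ Finset.range (k + 1), a j * e j x := by
      refine finsum_eq_sum_of_support_subset _ fun j hj => ?_
      by_contra hjk
      have hkj : k < j := by simpa using hjk
      refine hj ?_
      have := hqr k j hkj x hx
      simp only [he0 j x (Or.inl (by simp only [Set.mem_ofPred_eq]; linarith)), mul_zero]
    rw [this, Finset.mul_sum]
    exact Finset.sum_congr rfl fun j _ => by ring
  obtain ⟨C, hC⟩ := (hc g).bddAbove_range
  obtain ⟨k, hk⟩ := exists_nat_gt C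
  have : T (q k).2 g ≤ C := hC ⟨(q k).2, rfl⟩
  rw [hg k] at this
  exact this.not_gt hk

theorem IsCompact.isFunctionallyBounded {K : Set X} (hK : IsCompact K) :
    IsFunctionallyBounded K :=
  fun f => (hK.image f.continuous).isBounded

/-- `C(X, ℝ)` has the Grothendieck property if the functionally bounded subsets of `X` are
finite. -/
theorem grothendieckProperty_of_functionallyBounded_finite [T35Space X]
    (hX : ∀ A : Set X, IsFunctionallyBounded A → A.Finite) : GrothendieckProperty C(X, ℝ) := by
  classical
  rintro χ ⟨l, hl⟩
  rw [tendsto_iff_forall_eval_tendsto_topDualPairing] at hl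
  set m : StrongDual ℝ C(X, ℝ) := WeakDual.toStrongDual l
  have hl' : ∀ f, Tendsto (fun n => (χ n - m) f) atTop (𝓝 0) := fun f => by
    have h : Tendsto (fun n => χ n f) atTop (𝓝 (m f)) := hl f
    simpa using h.sub_const (m f)
  choose c hc using fun n => exists_finsupp_of_compact_finite
    (fun K hK => hX K hK.isFunctionallyBounded) (χ n - m)
  obtain ⟨S, hS⟩ := (hX _ (isFunctionallyBounded_iUnion_support c fun f => by
    simpa only [hc] using hl' f)).exists_finset_coe
  have hsub : ∀ n, (c n).support ⊆ S := fun n x hx => by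
    rw [← Finset.mem_coe, hS]
    exact Set.mem_iUnion.2 ⟨n, hx⟩
  have hcS : ∀ n f, (χ n - m) f = ∑ x ∈ S, c n x * f x := fun n f => by
    rw [hc n f, Finset.sum_subset (hsub n) fun x _ hx => by
      rw [Finsupp.notMem_support_iff.1 hx, zero_mul]]
  have hc0 : ∀ x ∈ S, Tendsto (fun n => c n x) atTop (𝓝 0) := by
    intro x hx
    obtain ⟨e, he1, he0, -⟩ := exists_bump (p := x) (S.erase x).finite_toSet.isClosed (by simp)
    refine (hl' e).congr fun n => ?_
    rw [hcS, Finset.sum_eq_single_of_mem x hx fun y hy hyx => by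
      rw [he0 y (by simp [hy, hyx]), mul_zero], he1, mul_one]
  refine ⟨toWeakSpace ℝ _ m, ?_⟩
  rw [tendsto_toWeakSpace_iff]
  intro φ
  have hχ : ∀ n, χ n = ∑ x ∈ S, c n x • ContinuousMap.evalCLM ℝ x + m := fun n => by
    ext f
    have := hcS n f
    simp only [sub_apply] at this
    simp [← this]
  simp only [hχ, map_add, map_sum, map_smul, LinearEquiv.symm_apply_apply]
  have h0 : Tendsto (fun n => ∑ x ∈ S, c n x • φ (ContinuousMap.evalCLM ℝ x)) atTop
      (𝓝 (∑ x ∈ S, (0 : ℝ) • φ (ContinuousMap.evalCLM ℝ x))) :=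
    tendsto_finsetSum _ fun x hx => (hc0 x hx).smul_const _
  simpa using h0.add_const (φ m)

theorem finite_of_isFunctionallyBounded_of_discrete [DiscreteTopology X] {A : Set X}
    (hA : IsFunctionallyBounded A) : A.Finite := by
  by_contra hinf
  have hinf : A.Infinite := hinf
  let u := hinf.natEmbedding
  let v : ℕ → X := fun n => u n
  have hv : Function.Injective v := Subtype.val_injective.comp u.injective
  obtain ⟨C, hC⟩ := (hA ⟨fun x => ((Function.invFun v x : ℕ) : ℝ), continuous_of_discreteTopology⟩).bddAbove
  obtain ⟨n, hn⟩ := exists_nat_gt C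
  have := hC ⟨v n, (u n).2, rfl⟩
  simp only [ContinuousMap.coe_mk, Function.leftInverse_invFun hv n] at this
  exact this.not_gt hn

end FiniteCombinations

/-! ### Cosmic spaces. -/

section Cosmic

variable {X : Type*} [TopologicalSpace X]

theorem IsFunctionallyBounded.closure {A : Set X} (hA : IsFunctionallyBounded A) :
    IsFunctionallyBounded (closure A) := fun f =>
  (hA f).closure.subset (image_closure_subset_closure_image f.continuous)

/-- Closed functionally bounded subsets of a Lindelöf Tychonoff space are compact. -/
theorem IsFunctionallyBounded.isCompact_of_isClosed [CompletelyRegularSpace X] [LindelofSpace X]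
    {A : Set X} (hA : IsFunctionallyBounded A) (hcl : IsClosed A) : IsCompact A := by
  classical
  refine isCompact_of_finite_subcover fun {ι} U hU hAU => ?_
  have hf : ∀ x : X, ∃ f : C(X, ℝ), f x = 1 ∧ (∀ y, 0 ≤ f y ∧ f y ≤ 1) ∧
      ((∀ y ∈ A, f y = 0) ∨ ∃ i, ∀ y, f y ≠ 0 → y ∈ U i) := by
    intro x
    by_cases hx : x ∈ A
    · obtain ⟨i, hi⟩ := Set.mem_iUnion.1 (hAU hx)
      obtain ⟨f, h1, h0, h⟩ := exists_bump (hU i).isClosed_compl (fun h : x ∈ (U i)ᶜ => h hi)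
      exact ⟨f, h1, h, Or.inr ⟨i, fun y hy => by_contra fun hyi => hy (h0 y hyi)⟩⟩
    · obtain ⟨f, h1, h0, h⟩ := exists_bump hcl hx
      exact ⟨f, h1, h, Or.inl h0⟩
  choose f hf1 hf01 hf using hf
  obtain ⟨t, ht, hcov⟩ := countable_cover_nhds (U := fun x => {y | 0 < f x y}) fun x =>
    (isOpen_lt continuous_const (f x).continuous).mem_nhds (by simp [hf1 x])
  by_cases hne : t.Nonempty
  swap
  · rw [Set.not_nonempty_iff_eq_empty] at hne
    subst hne
    have : A = ∅ := by
      refine Set.eq_empty_of_forall_notMem fun x _ => ?_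
      have := Set.mem_univ x
      rw [← hcov] at this
      simp at this
    exact ⟨∅, by simp [this]⟩
  obtain ⟨s, rfl⟩ := ht.exists_eq_range hne
  have hcov' : ∀ x, ∃ n, 0 < f (s n) x := fun x => by
    have := Set.mem_univ x
    rw [← hcov] at this
    simpa using this
  have hterm : ∀ n x, ‖(1 / 2 : ℝ) ^ n * f (s n) x‖ ≤ (1 / 2 : ℝ) ^ n := fun n x => by
    have h := hf01 (s n) x
    rw [Real.norm_of_nonneg (mul_nonneg (by positivity) h.1)]
    exact mul_le_of_le_one_right (by positivity) h.2
  have hsum : ∀ x, Summable fun n => (1 / 2 : ℝ) ^ n * f (s n) x := fun x =>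
    Summable.of_norm_bounded summable_geometric_two fun n => hterm n x
  have hcont : Continuous fun x => ∑' n, (1 / 2 : ℝ) ^ n * f (s n) x :=
    continuous_tsum (fun n => by fun_prop) summable_geometric_two hterm
  have hpos : ∀ x, 0 < ∑' n, (1 / 2 : ℝ) ^ n * f (s n) x := fun x => by
    obtain ⟨n, hn⟩ := hcov' x
    exact (hsum x).tsum_pos (fun k => mul_nonneg (by positivity) (hf01 _ _).1) n
      (mul_pos (by positivity) hn)
  obtain ⟨C, hC⟩ := (hA ⟨fun x => (∑' n, (1 / 2 : ℝ) ^ n * f (s n) x)⁻¹,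
    hcont.inv₀ fun x => (hpos x).ne'⟩).bddAbove
  -- If the first `N` terms vanished at a point of `A`, the sum would be at most `2 ^ (1 - N)` and
  -- its reciprocal would exceed `C`.
  obtain ⟨N, hN⟩ : ∃ N : ℕ, 2 * C < 2 ^ N := pow_unbounded_of_one_lt _ one_lt_two
  have hfin : ∀ x ∈ A, ∃ n < N, f (s n) x ≠ 0 := by
    intro x hx
    by_contra! hz
    have hle : ∑' n, (1 / 2 : ℝ) ^ n * f (s n) x ≤ (1 / 2 : ℝ) ^ N * 2 := by
      rw [← (hsum x).sum_add_tsum_nat_add N, Finset.sum_eq_zero fun n hn => by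
        rw [hz n (Finset.mem_range.1 hn), mul_zero], zero_add]
      refine le_of_le_of_eq ?_ (congrArg ((1 / 2 : ℝ) ^ N * ·) tsum_geometric_two)
      rw [← tsum_mul_left]
      refine ((summable_nat_add_iff N).2 (hsum x)).tsum_le_tsum (fun n => ?_)
        (summable_geometric_two.mul_left _)
      rw [← pow_add, add_comm N]
      exact (le_abs_self _).trans (hterm (n + N) x)
    have h1 : (∑' n, (1 / 2 : ℝ) ^ n * f (s n) x)⁻¹ ≤ C := hC ⟨x, hx, rfl⟩
    have h2 := inv_anti₀ (hpos x) hle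
    have h3 : ((1 / 2 : ℝ) ^ N * 2)⁻¹ = 2 ^ N / 2 := by
      rw [mul_inv, one_div, inv_pow, inv_inv]; ring
    linarith
  have hidx : ∀ n, ∃ J : Finset ι, ∀ x ∈ A, f (s n) x ≠ 0 → x ∈ ⋃ i ∈ J, U i := by
    intro n
    rcases hf (s n) with h | ⟨i, hi⟩
    · exact ⟨∅, fun x hx hne => absurd (h x hx) hne⟩
    · exact ⟨{i}, fun x _ hne => by simpa using hi x hne⟩
  choose J hJ using hidx
  refine ⟨(Finset.range N).biUnion J, fun x hx => ?_⟩
  obtain ⟨n, hnN, hne⟩ := hfin x hx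
  obtain ⟨i, hi, hxi⟩ := Set.mem_iUnion₂.1 (hJ n x hx hne)
  exact Set.mem_iUnion₂.2 ⟨i, Finset.mem_biUnion.2 ⟨n, Finset.mem_range.2 hnN, hi⟩, hxi⟩

/-- On a continuous image of a second countable space, countably many continuous functions
separate the points. -/
theorem exists_countable_continuousMap_separating [T35Space X] {Y : Type*} [TopologicalSpace Y]
    [SecondCountableTopology Y] {f : Y → X} (hf : Continuous f) (hsurj : Function.Surjective f) :
    ∃ T : Set C(X, ℝ), T.Countable ∧ ∀ x y : X, (∀ g ∈ T, g x = g y) → x = y := by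
  -- These open sets cover all pairs with distinct images, and `Y × Y` is second countable.
  obtain ⟨T, hT, hTU⟩ := TopologicalSpace.isOpen_iUnion_countable
    (fun g : C(X, ℝ) => {z : Y × Y | g (f z.1) ≠ g (f z.2)}) fun g =>
      isOpen_ne_fun (by fun_prop) (by fun_prop)
  refine ⟨T, hT, fun x y hxy => ?_⟩
  obtain ⟨a, rfl⟩ := hsurj x
  obtain ⟨b, rfl⟩ := hsurj y
  by_contra hne
  obtain ⟨g, hg1, hg0, -⟩ := exists_bump (isClosed_singleton (x := f b)) hne
  have hmem : (a, b) ∈ ⋃ g : C(X, ℝ), {z : Y × Y | g (f z.1) ≠ g (f z.2)} :=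
    Set.mem_iUnion.2 ⟨g, by simp [hg1, hg0 _ rfl]⟩
  rw [← hTU] at hmem
  obtain ⟨k, hk, hab⟩ := Set.mem_iUnion₂.1 hmem
  exact hab (hxy k hk)

/-- By compactness the separating functions embed `K` in a countable power of `ℝ`, so `K` is first
countable. -/
theorem sequentialSpace_of_countable_separating {T : Set C(X, ℝ)} (hT : T.Countable)
    (hsep : ∀ x y : X, (∀ g ∈ T, g x = g y) → x = y) {K : Set X} (hK : IsCompact K) :
    SequentialSpace K := by
  have := hT.to_subtype
  have := isCompact_iff_compactSpace.1 hK
  let F : K → T → ℝ := fun x g => g.1 x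
  have hF : Continuous F := by fun_prop
  have hemb : IsEmbedding F := (hF.isClosedEmbedding fun x y hxy =>
    Subtype.ext (hsep x y fun g hg => congrFun hxy ⟨g, hg⟩)).isEmbedding
  have := hemb.firstCountableTopology
  infer_instance

theorem IsCosmic.isMuSpace_and_sequentialSpace {X : Type u} [TopologicalSpace X]
    (hX : IsCosmic.{u, v} X) :
    IsMuSpace X ∧ ∀ K : Set X, IsCompact K → SequentialSpace K := by
  obtain ⟨h35, Y, _, _, _, f, hf, hsurj⟩ := hX
  let := TopologicalSpace.metrizableSpaceMetric Y
  have : SecondCountableTopology Y := UniformSpace.secondCountable_of_separable Y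
  have : LindelofSpace X := by
    rw [← isLindelof_univ_iff, ← hsurj.range_eq, ← Set.image_univ]
    exact isLindelof_univ.image hf
  obtain ⟨T, hT, hsep⟩ := exists_countable_continuousMap_separating hf hsurj
  exact ⟨⟨h35, fun A hA => hA.closure.isCompact_of_isClosed isClosed_closure⟩,
    fun K hK => sequentialSpace_of_countable_separating hT hsep hK⟩

end Cosmic

/-- If `C(X, ℝ)` has the Grothendieck property, compact sequential subsets of `X` are finite. -/
theorem GrothendieckProperty.finite_of_isCompact {X : Type*} [TopologicalSpace X] [T35Space X]
    (hG : GrothendieckProperty C(X, ℝ)) {K : Set X} (hK : IsCompact K) (hs : SequentialSpace K) :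
    K.Finite := by
  have := isCompact_iff_compactSpace.1 hK
  have hd : DiscreteTopology K := by
    by_contra hd
    obtain ⟨u, p, hu, hne⟩ := exists_tendsto_ne_of_not_discreteTopology hd
    exact not_grothendieckProperty_of_tendsto ((continuous_subtype_val.tendsto p).comp hu)
      (fun n h => hne n (Subtype.ext h)) hG
  exact Set.finite_coe_iff.1 finite_of_compact_of_discrete

theorem theoremt (X : Type u) [TopologicalSpace X] [T35Space X] :
    ((IsMuSpace X → (∀ K : Set X, IsCompact K → SequentialSpace K) →
        (GrothendieckProperty C(X, ℝ) ↔ ∀ A : Set X, IsFunctionallyBounded A → A.Finite)) ∧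
      (IsCosmic.{u, v} X → IsMuSpace X ∧ ∀ K : Set X, IsCompact K → SequentialSpace K)) ∧
    (SequentialSpace X → (GrothendieckProperty C(X, ℝ) ↔ DiscreteTopology X)) := by
  refine ⟨⟨fun hmu hseq => ⟨fun hG A hA => ?_, grothendieckProperty_of_functionallyBounded_finite⟩,
    IsCosmic.isMuSpace_and_sequentialSpace⟩, fun hseq => ⟨fun hG => ?_, fun hd => ?_⟩⟩
  · have hK := hmu.2 A hA
    exact (hG.finite_of_isCompact hK (hseq _ hK)).subset subset_closure
  · by_contra hd
    obtain ⟨u, p, hu, hne⟩ := exists_tendsto_ne_of_not_discreteTopology hd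
    exact not_grothendieckProperty_of_tendsto hu hne hG
  · exact grothendieckProperty_of_functionallyBounded_finite fun A hA =>
      finite_of_isFunctionallyBounded_of_discrete hA
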